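/- Let $(X,\|\cdot\|)$ be a finite-dimensional real Hilbert space with dual $X^*$. Let $J\in C^1(X,\mathbb{R})$ be a functional with compact derivative $J':X\to X^*$ (i.e. $J'$ is continuous and maps bounded sets to relatively compact sets). Let $\mu_1\in C^1(X,\mathbb{R})$ be coercive (i.e. $\mu_1(x)\to+\infty$ as $\|x\|\to\infty$), and suppose that its derivative $\mu_1':X\to X^*$ is a bijection with continuous inverse. Let $\mu_2\in C^1(X,[0,+\infty))$ be convex and coercive. Let $y\in X$ and $r>0$ be fixed, and assume, with infima and lower limits taken in $[-\infty,+\infty]$: (G.1) $\liminf_{\|x\|\to\infty} \frac{J(x)}{\mu_2(x)}\ge 0$; (G.2) $\inf_{x\in X} J(x) < \inf_{\mu_1(x)\le r} J(x)$; (G.3) $\mu_2(y)<r$ and $J(y)<\inf_{\mu_2(x)=r} J(x)$; (G.4) for all $x\in X$, if $\mu_2(x)\le r$ then $\mu_1(x)\le\mu_2(x)$; and there is a constant $M>0$ such that $\mu_1(x)\ge\mu_2(x)$ whenever $\|x\|\ge M$; (G.5) $J$ is convex on the convex hull of $B:=\{x\in X:\mu_1(x)\le r\}$. Then there exists a nonempty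 open set $A\subseteq(0,+\infty)$ such that for every $\lambda\in A$ the functional $x\mapsto \mu_1(x)+\lambda J(x)$ has at least three critical points in $X$. -/

import Mathlib

open Filter Topology Bornology

namespace ThreeCritical

variable {X : Type*} [NormedAddCommGroup X] [InnerProductSpace ℝ X]

/-- A functional is coercive if `f x → +∞` as `‖x‖ → ∞`. -/
def Coercive (f : X → ℝ) : Prop :=
  Tendsto f (cobounded X) atTop

/-- The (nonlinear) derivative operator `f' : X → X*` is compact: it is continuous and maps
bounded sets to relatively compact sets. -/
def HasCompactDerivative (f : X → ℝ) : Prop :=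
  Continuous (fderiv ℝ f) ∧ ∀ S : Set X, IsBounded S → IsCompact (closure (fderiv ℝ f '' S))

/-- The derivative operator `f' : X → X*` admits a continuous inverse `X* → X`. -/
def DerivativeHasContinuousInverse (f : X → ℝ) : Prop :=
  ∃ g : StrongDual ℝ X → X, Continuous g ∧
    Function.LeftInverse g (fderiv ℝ f) ∧ Function.RightInverse g (fderiv ℝ f)

/-- `x` is a critical point of `f`: `f` is differentiable at `x` with derivative zero. -/
def IsCriticalPoint (f : X → ℝ) (x : X) : Prop :=
  HasFDerivAt f (0 : StrongDual ℝ X) x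

end ThreeCritical

namespace ThreeCritical

/-! For `l > 0`, `f = μ₁ + l * J` is coercive. On `B = {μ₁ ≤ r}`, convexity and (G.3) put a
minimizer of `J` in `{μ₁ < r}`, so `f` has a local minimum there. By (G.2), `J` takes lower values
outside `B`, so for large `l` the global minimum of `f` lies outside `B`. Two distinct local minima
force a third critical point by a mountain pass argument, where discrete gradient steps replace a
deformation flow and compact sublevel sets replace a Palais–Smale condition. -/

lemma three_le_encard_of_mem {α : Type*} {s : Set α} {a b c : α} (ha : a ∈ s) (hb : b ∈ s)
    (hc : c ∈ s) (hab : a ≠ b) (hac : a ≠ c) (hbc : b ≠ c) : 3 ≤ s.encard := by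
  rw [← Set.encard_eq_three.2 ⟨a, b, c, hab, hac, hbc, rfl⟩]
  refine Set.encard_le_encard ?_
  rintro x (rfl | rfl | rfl) <;> assumption

variable {X : Type*} [NormedAddCommGroup X]

/-- The levels `a` for which a connected subset of the sublevel set of `a` joins `x₀` to `x₁`. -/
def connectingLevels (f : X → ℝ) (x₀ x₁ : X) : Set ℝ :=
  {a | ∃ K : Set X, IsPreconnected K ∧ x₀ ∈ K ∧ x₁ ∈ K ∧ ∀ x ∈ K, f x ≤ a}

lemma bddBelow_connectingLevels (f : X → ℝ) (x₀ x₁ : X) :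
    BddBelow (connectingLevels f x₀ x₁) :=
  ⟨f x₀, fun _ ⟨_, _, h₀, _, h⟩ => h _ h₀⟩

/-- Far out, `J / μ₂ > -1 / (2 * l)`, hence `l * J > -μ₂ / 2 ≥ -μ₁ / 2` and the sum exceeds `μ₁ /
2`. -/
lemma coercive_add_mul {J μ₁ μ₂ : X → ℝ} (hμ₁ : Coercive μ₁) (hμ₂ : Coercive μ₂)
    (hlim : 0 ≤ liminf (fun x : X => ((J x / μ₂ x : ℝ) : EReal)) (cobounded X))
    (hle : ∀ᶠ x in cobounded X, μ₂ x ≤ μ₁ x) {l : ℝ} (hl : 0 < l) :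
    Coercive fun x => μ₁ x + l * J x := by
  have hneg : ((-(1 / (2 * l)) : ℝ) : EReal) <
      liminf (fun x : X => ((J x / μ₂ x : ℝ) : EReal)) (cobounded X) := by
    refine lt_of_lt_of_le ?_ hlim
    have : -(1 / (2 * l)) < 0 := by
      rw [neg_lt_zero]
      positivity
    exact_mod_cast this
  have hev := eventually_lt_of_lt_liminf hneg
  refine tendsto_atTop_mono' _ ?_ (hμ₁.atTop_div_const (two_pos : (0 : ℝ) < 2))
  filter_upwards [hev, hle, hμ₂.eventually_gt_atTop 0] with x h1 h2 h3
  have h4 : -(1 / (2 * l)) < J x / μ₂ x := by exact_mod_cast h1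
  rw [lt_div_iff₀ h3] at h4
  have h5 : l * (-(1 / (2 * l)) * μ₂ x) < l * J x := mul_lt_mul_of_pos_left h4 hl
  have h6 : l * (-(1 / (2 * l)) * μ₂ x) = -(μ₂ x / 2) := by
    field_simp
  linarith

variable [InnerProductSpace ℝ X]

lemma isCriticalPoint_iff {f : X → ℝ} (hf : ContDiff ℝ 1 f) {x : X} :
    IsCriticalPoint f x ↔ fderiv ℝ f x = 0 := by
  refine ⟨fun h => h.fderiv, fun h => ?_⟩
  have := (hf.differentiable one_ne_zero x).hasFDerivAt
  rwa [h] at this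

lemma isCriticalPoint_of_isLocalMin {f : X → ℝ} (hf : ContDiff ℝ 1 f) {x : X}
    (h : IsLocalMin f x) : IsCriticalPoint f x :=
  (isCriticalPoint_iff hf).2 h.fderiv_eq_zero

lemma connectingLevels_nonempty {f : X → ℝ} (hf : Continuous f) (x₀ x₁ : X) :
    (connectingLevels f x₀ x₁).Nonempty := by
  have hK : IsCompact (segment ℝ x₀ x₁) := by
    rw [segment_eq_image_lineMap]
    exact isCompact_Icc.image (AffineMap.lineMap_continuous)
  obtain ⟨a, ha⟩ := (hK.image hf).bddAbove
  exact ⟨a, segment ℝ x₀ x₁, (convex_segment x₀ x₁).isPreconnected, left_mem_segment ℝ x₀ x₁,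
    right_mem_segment ℝ x₀ x₁, fun x hx => ha ⟨x, hx, rfl⟩⟩

variable [FiniteDimensional ℝ X]

lemma Coercive.isCompact_sublevel {f : X → ℝ} (hc : Continuous f) (hf : Coercive f) (a : ℝ) :
    IsCompact {x | f x ≤ a} := by
  refine Metric.isCompact_of_isClosed_isBounded (isClosed_le hc continuous_const) ?_
  have h : ∀ᶠ x in cobounded X, a < f x := hf.eventually_gt_atTop a
  rw [← isCobounded_compl_iff]
  filter_upwards [h] with x hx using not_le.2 hx

/-- One step of gradient descent, of length proportional to `s`. -/
noncomputable def descentStep (f : X → ℝ) (s : ℝ) (x : X) : X :=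
  x - s • (InnerProductSpace.toDual ℝ X).symm (fderiv ℝ f x)

lemma continuous_descentStep {f : X → ℝ} (hf : ContDiff ℝ 1 f) :
    Continuous fun p : X × ℝ => descentStep f p.2 p.1 := by
  have h := hf.continuous_fderiv one_ne_zero
  unfold descentStep
  fun_prop

lemma descentStep_of_isCriticalPoint {f : X → ℝ} {x : X} (h : IsCriticalPoint f x) (s : ℝ) :
    descentStep f s x = x := by
  have := h.fderiv
  simp [descentStep, this]

/-- Strict differentiability makes the decrease uniform in the base point near `x`, as the
compactness argument requires. -/
lemma eventually_descentStep_lt {f : X → ℝ} (hf : ContDiff ℝ 1 f) {x : X}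
    (hx : ¬ IsCriticalPoint f x) :
    ∀ᶠ p : X × ℝ in 𝓝 (x, 0), 0 < p.2 → f (descentStep f p.2 p.1) < f p.1 := by
  set g : X → X := fun z => (InnerProductSpace.toDual ℝ X).symm (fderiv ℝ f z) with hg
  have hgc : Continuous g := by
    have h := hf.continuous_fderiv one_ne_zero
    fun_prop
  have hgx : 0 < ‖g x‖ := by
    rw [isCriticalPoint_iff hf] at hx
    simpa [hg] using hx
  have hstrict : HasStrictFDerivAt f (fderiv ℝ f x) x :=
    hf.contDiffAt.hasStrictFDerivAt one_ne_zero
  have hpair : Tendsto (fun p : X × ℝ => (descentStep f p.2 p.1, p.1)) (𝓝 (x, 0)) (𝓝 (x, x)) := by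
    have h : Continuous fun p : X × ℝ => (descentStep f p.2 p.1, p.1) :=
      (continuous_descentStep hf).prodMk continuous_fst
    have := h.tendsto (x, 0)
    simpa [descentStep] using this
  have hsmall := hpair.eventually (hstrict.isLittleO.bound (half_pos hgx))
  have hpos : ∀ᶠ p : X × ℝ in 𝓝 (x, 0),
      0 < fderiv ℝ f x (g p.1) - ‖g x‖ / 2 * ‖g p.1‖ := by
    have hcont : Continuous fun p : X × ℝ =>
        fderiv ℝ f x (g p.1) - ‖g x‖ / 2 * ‖g p.1‖ := by fun_prop
    refine hcont.continuousAt.eventually_const_lt ?_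
    have hval : fderiv ℝ f x (g x) = ‖g x‖ ^ 2 := by
      rw [← real_inner_self_eq_norm_sq]
      exact InnerProductSpace.toDual_symm_apply.symm
    simp only [hval]
    nlinarith
  filter_upwards [hsmall, hpos] with p h1 h2 hp
  have h3 : descentStep f p.2 p.1 - p.1 = -(p.2 • g p.1) := by
    simp [descentStep, hg]
  simp only [h3, norm_neg, norm_smul, map_neg, map_smul, smul_eq_mul, Real.norm_eq_abs,
    abs_of_pos hp] at h1
  have h4 := (abs_le.1 h1).2
  have h5 := mul_pos hp h2
  nlinarith

/-- Below level `c` continuity suffices; on it the gradient is nonzero. Compactness of the sublevel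
set gives a common step. -/
lemma exists_descentStep_lt {f : X → ℝ} (hf : ContDiff ℝ 1 f) (hco : Coercive f) {c : ℝ}
    (hc : ∀ x, f x = c → ¬ IsCriticalPoint f x) :
    ∃ s : ℝ, ∀ x, f x ≤ c → f (descentStep f s x) < c := by
  have hK := hco.isCompact_sublevel hf.continuous c
  have hev : ∀ᶠ s : ℝ in 𝓝 0, ∀ x ∈ {x | f x ≤ c},
      0 < s → f x ≤ c → f (descentStep f s x) < c := by
    refine hK.eventually_forall_of_forall_eventually fun x hx => ?_
    rcases lt_or_eq_of_le (show f x ≤ c from hx) with h | h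
    · have hcont : Continuous fun p : ℝ × X => f (descentStep f p.1 p.2) :=
        hf.continuous.comp ((continuous_descentStep hf).comp continuous_swap)
      have : ∀ᶠ p : ℝ × X in 𝓝 (0, x), f (descentStep f p.1 p.2) < c :=
        hcont.continuousAt.eventually_lt_const (by simpa [descentStep] using h)
      filter_upwards [this] with p hp _ _ using hp
    · filter_upwards [(continuous_swap.tendsto ((0 : ℝ), x)).eventually
        (eventually_descentStep_lt hf (hc x h))] with p hp h1 h2
      exact (hp h1).trans_le h2
  obtain ⟨s, hs, hs0⟩ := ((hev.filter_mono nhdsWithin_le_nhds).and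
    (self_mem_nhdsWithin : Set.Ioi (0 : ℝ) ∈ 𝓝[>] 0)).exists
  exact ⟨s, fun x hx => hs x hx hs0 hx⟩

/-- Minimax principle: the least level at which two critical points of a coercive `C¹` function
are joined is a critical value. -/
lemma exists_isCriticalPoint_eq_sInf_connectingLevels {f : X → ℝ} (hf : ContDiff ℝ 1 f)
    (hco : Coercive f) {x₀ x₁ : X} (h₀ : IsCriticalPoint f x₀) (h₁ : IsCriticalPoint f x₁) :
    ∃ x, f x = sInf (connectingLevels f x₀ x₁) ∧ IsCriticalPoint f x := by
  set c := sInf (connectingLevels f x₀ x₁) with hcdef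
  by_contra! hcon
  obtain ⟨s, hs⟩ := exists_descentStep_lt hf hco hcon
  have hcont : Continuous (descentStep f s) :=
    (continuous_descentStep hf).comp (continuous_id.prodMk continuous_const)
  have hfcont : Continuous fun x => f (descentStep f s x) := hf.continuous.comp hcont
  have hbad : IsCompact {x | f x ≤ c + 1 ∧ c ≤ f (descentStep f s x)} :=
    (hco.isCompact_sublevel hf.continuous (c + 1)).inter_right
      (isClosed_le continuous_const hfcont)
  -- Points with `f ≤ c + 1` not pushed below `c` form a compact set, on which the least value of
  -- `f` exceeds `c`.
  obtain ⟨b, hcb, hb⟩ : ∃ b, c < b ∧ ∀ x, f x < b → f (descentStep f s x) < c := by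
    rcases Set.eq_empty_or_nonempty {x | f x ≤ c + 1 ∧ c ≤ f (descentStep f s x)} with he | hne
    · refine ⟨c + 1, by linarith, fun x hx => ?_⟩
      by_contra! h
      exact (Set.eq_empty_iff_forall_notMem.1 he x) ⟨hx.le, h⟩
    · obtain ⟨w, hw, hmin⟩ := hbad.exists_isMinOn hne hf.continuous.continuousOn
      refine ⟨f w, ?_, fun x hx => ?_⟩
      · by_contra! h
        exact (hs w h).not_ge hw.2
      · by_contra! h
        exact hx.not_ge (hmin ⟨hx.le.trans hw.1, h⟩)
  obtain ⟨a, ⟨K, hK, hK₀, hK₁, hKa⟩, hab⟩ :=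
    exists_lt_of_csInf_lt (connectingLevels_nonempty hf.continuous x₀ x₁) hcb
  obtain ⟨w, hw, hmax⟩ := (hco.isCompact_sublevel hf.continuous a).exists_isMaxOn
    ⟨x₀, hKa _ hK₀⟩ hfcont.continuousOn
  -- The step fixes the critical endpoints, so the image of `K` still joins them, now at a level
  -- below `c`.
  have hmem : f (descentStep f s w) ∈ connectingLevels f x₀ x₁ := by
    refine ⟨descentStep f s '' K, hK.image _ hcont.continuousOn,
      ⟨x₀, hK₀, descentStep_of_isCriticalPoint h₀ s⟩,
      ⟨x₁, hK₁, descentStep_of_isCriticalPoint h₁ s⟩, ?_⟩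
    rintro _ ⟨x, hx, rfl⟩
    exact hmax (hKa x hx)
  exact (hb w (lt_of_le_of_lt hw hab)).not_ge (csInf_le (bddBelow_connectingLevels f x₀ x₁) hmem)

/-- A coercive `C¹` function with two distinct local minima has three critical points. -/
theorem three_le_encard_criticalPoints_of_isLocalMin {f : X → ℝ} (hf : ContDiff ℝ 1 f)
    (hco : Coercive f) {x₀ x₁ : X} (h₀ : IsLocalMin f x₀) (h₁ : IsLocalMin f x₁)
    (hne : x₀ ≠ x₁) : 3 ≤ {x | IsCriticalPoint f x}.encard := by
  -- With `x₀` the higher minimum, a critical value above `f x₀` differs from both.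
  wlog hle : f x₁ ≤ f x₀ generalizing x₀ x₁
  · exact this h₁ h₀ hne.symm (not_le.1 hle).le
  have hc₀ := isCriticalPoint_of_isLocalMin hf h₀
  have hc₁ := isCriticalPoint_of_isLocalMin hf h₁
  by_cases hthird : ∃ x₂, IsCriticalPoint f x₂ ∧ x₀ ≠ x₂ ∧ x₁ ≠ x₂
  · obtain ⟨x₂, hc₂, h02, h12⟩ := hthird
    exact three_le_encard_of_mem hc₀ hc₁ hc₂ hne h02 h12
  push Not at hthird
  obtain ⟨ε, hε, hmin⟩ := Metric.eventually_nhds_iff_ball.1 h₀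
  have hd : 0 < dist x₁ x₀ := dist_pos.2 hne.symm
  obtain ⟨ρ, hρ, hρ'⟩ := exists_between (lt_min hε hd)
  obtain ⟨hρε, hρd⟩ := lt_min_iff.1 hρ'
  have : Nontrivial X := ⟨x₀, x₁, hne⟩
  obtain ⟨w, hw, hwmin⟩ := (isCompact_sphere x₀ ρ).exists_isMinOn
    (NormedSpace.sphere_nonempty.2 hρ.le) hf.continuous.continuousOn
  have hwd : dist w x₀ = ρ := hw
  have hwε : w ∈ Metric.ball x₀ ε := hwd.trans_lt hρε
  -- Equality would make `w` a local minimum, hence a third critical point.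
  have hw0 : f x₀ < f w := by
    refine lt_of_le_of_ne (hmin w hwε) fun heq => ?_
    have hwloc : IsLocalMin f w := by
      filter_upwards [Metric.isOpen_ball.mem_nhds hwε] with z hz
      exact heq ▸ hmin z hz
    have h0w : x₀ ≠ w := by
      rintro rfl
      simp [hρ.ne] at hwd
    have := hthird w (isCriticalPoint_of_isLocalMin hf hwloc) h0w
    rw [this, hwd] at hρd
    exact lt_irrefl _ hρd
  obtain ⟨x, hx, hxc⟩ := exists_isCriticalPoint_eq_sInf_connectingLevels hf hco hc₀ hc₁
  have hlevel : f w ≤ f x := by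
    rw [hx]
    refine le_csInf (connectingLevels_nonempty hf.continuous x₀ x₁) ?_
    rintro a ⟨K, hK, hK₀, hK₁, hKa⟩
    obtain ⟨z, hzK, hz⟩ := hK.intermediate_value hK₀ hK₁
      (f := fun z => dist z x₀) (by fun_prop) (show ρ ∈ Set.Icc _ _ by
        simpa using ⟨hρ.le, hρd.le⟩)
    exact (hwmin (show z ∈ Metric.sphere x₀ ρ from hz)).trans (hKa z hzK)
  exact three_le_encard_of_mem hc₀ hc₁ hxc hne
    (by rintro rfl; linarith) (by rintro rfl; linarith)

/-- If the minimizer had `μ₂ ≥ r`, the segment from `y` to it would meet `{μ₂ = r}` at a point where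
convexity bounds `J` by `J y`. -/
lemma exists_isMinOn_sublevel_lt {J μ₁ μ₂ : X → ℝ} (hJ : Continuous J)
    (hμ₁ : Continuous μ₁) (hμ₁coercive : Coercive μ₁) (hμ₂ : Continuous μ₂) {y : X} {r : ℝ}
    (hy : μ₂ y < r) (hJy : ∀ x, μ₂ x = r → J y < J x) (hle : ∀ x, μ₂ x ≤ r → μ₁ x ≤ μ₂ x)
    (hconv : ConvexOn ℝ (convexHull ℝ {x : X | μ₁ x ≤ r}) J) :
    ∃ x, μ₁ x < r ∧ IsMinOn J {x | μ₁ x ≤ r} x := by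
  have hyB : y ∈ {x | μ₁ x ≤ r} := (hle y hy.le).trans hy.le
  obtain ⟨x, hx, hmin⟩ := (hμ₁coercive.isCompact_sublevel hμ₁ r).exists_isMinOn ⟨y, hyB⟩
    hJ.continuousOn
  have hxy : J x ≤ J y := hmin hyB
  suffices h : μ₂ x < r from ⟨x, (hle x h.le).trans_lt h, hmin⟩
  by_contra! hr
  obtain ⟨w, hw, hwr⟩ := (convex_segment (𝕜 := ℝ) y x).isPreconnected.intermediate_value
    (left_mem_segment ℝ y x) (right_mem_segment ℝ y x) hμ₂.continuousOn ⟨hy.le, hr⟩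
  have hmax := hconv.le_max_of_mem_segment (subset_convexHull ℝ _ hyB)
    (subset_convexHull ℝ _ hx) hw
  rw [max_eq_left hxy] at hmax
  exact (hJy w hwr).not_ge hmax

/-- A minimizer `z` of the sum on the sublevel set has `J z ≥ J x`, which forces `μ₁ z ≤ μ₁ x < r`.
-/
lemma exists_isLocalMin_mem_sublevel {J μ₁ : X → ℝ} (hJ : Continuous J) (hμ₁ : Continuous μ₁)
    (hμ₁coercive : Coercive μ₁) {r : ℝ} {x : X} (hx : μ₁ x < r)
    (hmin : IsMinOn J {x | μ₁ x ≤ r} x) {l : ℝ} (hl : 0 < l) :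
    ∃ z, μ₁ z < r ∧ IsLocalMin (fun x => μ₁ x + l * J x) z := by
  obtain ⟨z, hz, hzmin⟩ := (hμ₁coercive.isCompact_sublevel hμ₁ r).exists_isMinOn ⟨x, hx.le⟩
    (f := fun x => μ₁ x + l * J x) (by fun_prop)
  have h1 : μ₁ z + l * J z ≤ μ₁ x + l * J x := hzmin (show x ∈ {x | μ₁ x ≤ r} from hx.le)
  have h2 : l * J x ≤ l * J z := mul_le_mul_of_nonneg_left (hmin hz) hl.le
  have hzr : μ₁ z < r := by linarith
  exact ⟨z, hzr, hzmin.isLocalMin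
    (mem_of_superset ((isOpen_lt hμ₁ continuous_const).mem_nhds hzr) fun _ (h : μ₁ _ < r) => h.le)⟩

lemma Coercive.exists_forall_le {f : X → ℝ} (hc : Continuous f) (hf : Coercive f) :
    ∃ x, ∀ z, f x ≤ f z := by
  refine hc.exists_forall_le ?_
  rwa [← Metric.cobounded_eq_cocompact]

end ThreeCritical

/-- Infima and the lower limit are taken in the extended reals, so that `inf J = -∞` is allowed. -/
theorem mainTheorem2 {X : Type*} [NormedAddCommGroup X] [InnerProductSpace ℝ X]
    [FiniteDimensional ℝ X] (J μ₁ μ₂ : X → ℝ)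
    (hJ : ContDiff ℝ 1 J) (hJcompact : ThreeCritical.HasCompactDerivative J)
    (hμ₁ : ContDiff ℝ 1 μ₁) (hμ₁coercive : ThreeCritical.Coercive μ₁)
    (hμ₁inv : ThreeCritical.DerivativeHasContinuousInverse μ₁)
    (hμ₂ : ContDiff ℝ 1 μ₂) (hμ₂nonneg : ∀ x, 0 ≤ μ₂ x)
    (hμ₂convex : ConvexOn ℝ Set.univ μ₂) (hμ₂coercive : ThreeCritical.Coercive μ₂)
    (y : X) (r : ℝ) (hr : 0 < r)
    (hG1 : 0 ≤ liminf (fun x : X => ((J x / μ₂ x : ℝ) : EReal)) (cobounded X))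
    (hG2 : (⨅ x : X, (J x : EReal)) < ⨅ x ∈ {x : X | μ₁ x ≤ r}, (J x : EReal))
    (hG3 : μ₂ y < r ∧ (J y : EReal) < ⨅ x ∈ {x : X | μ₂ x = r}, (J x : EReal))
    (hG4 : (∀ x, μ₂ x ≤ r → μ₁ x ≤ μ₂ x) ∧ ∃ M : ℝ, 0 < M ∧ ∀ x, M ≤ ‖x‖ → μ₂ x ≤ μ₁ x)
    (hG5 : ConvexOn ℝ (convexHull ℝ {x : X | μ₁ x ≤ r}) J) :
    ∃ A : Set ℝ, IsOpen A ∧ A.Nonempty ∧ A ⊆ Set.Ioi 0 ∧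
      ∀ l ∈ A, 3 ≤ {x : X | ThreeCritical.IsCriticalPoint (fun z => μ₁ z + l * J z) x}.encard := by
  have hlt : ∀ x, μ₂ x = r → J y < J x := fun x hx => by
    have h := hG3.2.trans_le (iInf₂_le x hx)
    exact_mod_cast h
  obtain ⟨hle, M, -, hM⟩ := hG4
  obtain ⟨x, hxr, hxmin⟩ := ThreeCritical.exists_isMinOn_sublevel_lt hJ.continuous hμ₁.continuous
    hμ₁coercive hμ₂.continuous hG3.1 hlt hle hG5
  obtain ⟨z, hz⟩ := iInf_lt_iff.1 hG2
  have hzx : J z < J x := by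
    have h := hz.trans_le (iInf₂_le x (show x ∈ {x : X | μ₁ x ≤ r} from hxr.le))
    exact_mod_cast h
  obtain ⟨p, hp⟩ := hμ₁coercive.exists_forall_le hμ₁.continuous
  have hev : ∀ᶠ x in cobounded X, μ₂ x ≤ μ₁ x := by
    filter_upwards [tendsto_norm_cobounded_atTop.eventually_ge_atTop M] with x hx using hM x hx
  -- Beyond this threshold, `f z < μ₁ p + l * J x`, a lower bound for `f` on `B`.
  refine ⟨Set.Ioi ((μ₁ z - μ₁ p) / (J x - J z)), isOpen_Ioi, Set.nonempty_Ioi, ?_, ?_⟩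
  · exact Set.Ioi_subset_Ioi (div_nonneg (sub_nonneg.2 (hp z)) (sub_pos.2 hzx).le)
  intro l hl
  have hl0 : 0 < l := (div_nonneg (sub_nonneg.2 (hp z)) (sub_pos.2 hzx).le).trans_lt hl
  have hl' : μ₁ z - μ₁ p < l * (J x - J z) := (div_lt_iff₀ (sub_pos.2 hzx)).1 hl
  have hf : ContDiff ℝ 1 fun z => μ₁ z + l * J z := hμ₁.add (contDiff_const.mul hJ)
  have hco := ThreeCritical.coercive_add_mul hμ₁coercive hμ₂coercive hG1 hev hl0
  obtain ⟨x₀, hx₀r, hx₀⟩ := ThreeCritical.exists_isLocalMin_mem_sublevel hJ.continuous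
    hμ₁.continuous hμ₁coercive hxr hxmin hl0
  obtain ⟨x₁, hx₁⟩ := hco.exists_forall_le hf.continuous
  refine ThreeCritical.three_le_encard_criticalPoints_of_isLocalMin hf hco hx₀
    (Eventually.of_forall hx₁) ?_
  rintro rfl
  have h1 : μ₁ x₀ + l * J x₀ ≤ μ₁ z + l * J z := hx₁ z
  have h2 : l * J x ≤ l * J x₀ :=
    mul_le_mul_of_nonneg_left (hxmin (show x₀ ∈ {x : X | μ₁ x ≤ r} from hx₀r.le)) hl0.le
  linarith [hp x₀]
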